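/- Let $R$ be a commutative Bezout domain, that is, a commutative integral domain with identity in which every finitely generated ideal is principal. Suppose that $R$ is a $PM^{*}$ ring, that is, every nonzero prime ideal of $R$ is contained in a unique maximal ideal of $R$. Then $R$ is an elementary divisor domain: for all $m,n$ and every $m\times n$ matrix $A$ over $R$ there exist invertible matrices $P\in GL_m(R)$ and $Q\in GL_n(R)$ such that $PAQ$ is a diagonal matrix $\operatorname{diag}(d_1,d_2,\dots)$ (of size $m\times n$) with $d_i\mid d_{i+1}$ for every $i$ with $1\le i<\min(m,n)$. -/

import Mathlib

/-- A (commutative) `PM*` ring: every nonzero prime ideal is contained in a unique maximal ideal. -/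
def IsPMStarRing (R : Type*) [CommRing R] : Prop :=
  ∀ P : Ideal R, P.IsPrime → P ≠ ⊥ → ∃! M : Ideal R, M.IsMaximal ∧ P ≤ M

/-- A rectangular matrix `D` is diagonal, `D = diag(d₀, d₁, …)`, and each diagonal entry
divides the next one. -/
def IsDivisorDiagonal {R : Type*} [CommRing R] {m n : ℕ} (D : Matrix (Fin m) (Fin n) R) : Prop :=
  (∀ (i : Fin m) (j : Fin n), (i : ℕ) ≠ (j : ℕ) → D i j = 0) ∧
  ∀ (k : ℕ) (hm : k + 1 < m) (hn : k + 1 < n),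
    D ⟨k, Nat.lt_of_succ_lt hm⟩ ⟨k, Nat.lt_of_succ_lt hn⟩ ∣ D ⟨k + 1, hm⟩ ⟨k + 1, hn⟩

/-- A commutative elementary divisor ring in the sense of Kaplansky: for every rectangular
matrix `A` there are invertible square matrices `P`, `Q` such that `P * A * Q` is diagonal with
each diagonal entry dividing the next one. -/
def IsElementaryDivisorRing (R : Type*) [CommRing R] : Prop :=
  ∀ (m n : ℕ) (A : Matrix (Fin m) (Fin n) R),
    ∃ (P : Matrix (Fin m) (Fin m) R) (Q : Matrix (Fin n) (Fin n) R),
      IsUnit P ∧ IsUnit Q ∧ IsDivisorDiagonal (P * A * Q)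

/-! It suffices that the bilinear form `p ⬝ᵥ A *ᵥ x` attains a gcd `d` of the entries of `A`. For `A
≠ 0`, such `p` and `x` are then unimodular, so over a Bezout domain they extend to invertible
matrices that move `d` to the corner; row and column operations clear the rest, and induction on the
number of rows finishes.

Attaining the gcd reduces, row by row, to lower triangular `2 × 2` matrices with rows `(h, 0)` and
`(z, w)`. Only there is the `PM*` property used: it splits `z` into a factor coprime to `h` and one
coprime to `w` (`IsPMStarRing.exists_eq_mul`), from which `IsPMStarRing.exists_triangular_eq_one`
writes down explicit solutions. -/

section CoprimeSplitting

variable {R : Type*} [CommRing R]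

/-- In a `PM*` ring, a nonzero element has a multiple `u * v` with `u` coprime to `h` and `v`
coprime to `w`, whenever `h` and `w` are coprime. -/
theorem IsPMStarRing.exists_dvd_mul (hR : IsPMStarRing R) {z h w : R} (hz : z ≠ 0)
    (hw : IsCoprime h w) :
    ∃ u v : R, z ∣ u * v ∧ IsCoprime u h ∧ IsCoprime v w := by
  by_contra! hcon
  let S : Submonoid R :=
    { carrier := {s | ∃ u v, s = u * v ∧ IsCoprime u h ∧ IsCoprime v w}
      one_mem' := ⟨1, 1, by simp, isCoprime_one_left, isCoprime_one_left⟩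
      mul_mem' := by
        rintro _ _ ⟨u, v, rfl, hu, hv⟩ ⟨u', v', rfl, hu', hv'⟩
        exact ⟨u * u', v * v', by ring, hu.mul_left hu', hv.mul_left hv'⟩ }
  have hdisj : Disjoint (Ideal.span {z} : Set R) S := by
    rw [Set.disjoint_left]
    rintro s hs ⟨u, v, rfl, hu, hv⟩
    exact hcon u v (Ideal.mem_span_singleton.1 hs) hu hv
  -- The maximal ideal above this prime will contain both `h` and `w`, contradicting their
  -- coprimality.
  obtain ⟨P, hP, hzP, hPS⟩ := Ideal.exists_le_prime_disjoint _ S hdisj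
  have hzP' : z ∈ P := hzP (Ideal.mem_span_singleton_self z)
  have hP0 : P ≠ ⊥ := by
    rintro rfl
    exact hz (by simpa using hzP')
  obtain ⟨M, -, hM⟩ := hR P hP hP0
  -- If no element of `P` is coprime to `x`, then `P + (x)` is proper, and a maximal ideal above it
  -- also lies above `P`, so it is `M`.
  have key : ∀ x : R, (∀ u ∈ P, ¬ IsCoprime u x) → x ∈ M := by
    intro x hx
    have hne : P ⊔ Ideal.span {x} ≠ ⊤ := by
      rw [Ne, Ideal.eq_top_iff_one, Submodule.mem_sup]
      rintro ⟨u, hu, y, hy, huy⟩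
      obtain ⟨c, rfl⟩ := Ideal.mem_span_singleton'.1 hy
      exact hx u hu ⟨1, c, by rw [one_mul, huy]⟩
    obtain ⟨N, hN, hle⟩ := Ideal.exists_le_maximal _ hne
    rw [← hM N ⟨hN, le_sup_left.trans hle⟩]
    exact hle (Ideal.mem_sup_right (Ideal.mem_span_singleton_self x))
  have hhM : h ∈ M := key h fun u hu hc =>
    Set.disjoint_left.1 hPS hu ⟨u, 1, by simp, hc, isCoprime_one_left⟩
  have hwM : w ∈ M := key w fun v hv hc =>
    Set.disjoint_left.1 hPS hv ⟨1, v, by simp, isCoprime_one_left, hc⟩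
  obtain ⟨N, ⟨hN, hPN⟩, hNu⟩ := hR P hP hP0
  obtain rfl := hM N ⟨hN, hPN⟩
  obtain ⟨a, b, hab⟩ := hw
  exact hN.ne_top ((Ideal.eq_top_iff_one _).2
    (hab ▸ add_mem (N.mul_mem_left a hhM) (N.mul_mem_left b hwM)))

variable [IsDomain R] [IsBezout R]

theorem IsPMStarRing.exists_eq_mul (hR : IsPMStarRing R) {z h w : R} (hz : z ≠ 0)
    (hw : IsCoprime h w) :
    ∃ u v : R, z = u * v ∧ IsCoprime u h ∧ IsCoprime v w := by
  obtain ⟨u, v, hdvd, hu, hv⟩ := hR.exists_dvd_mul hz hw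
  obtain ⟨u', v', hu', hv', rfl⟩ := exists_dvd_and_dvd_of_dvd_mul hdvd
  exact ⟨u', v', rfl, hu.of_isCoprime_of_dvd_left hu', hv.of_isCoprime_of_dvd_left hv'⟩

/-- Over a Bezout domain two elements, not both zero, are coprime multiples of a common
linear combination. -/
theorem IsBezout.exists_eq_mul_isCoprime {x y : R} (hxy : x ≠ 0 ∨ y ≠ 0) :
    ∃ g a b s t : R, g ≠ 0 ∧ x = g * a ∧ y = g * b ∧ s * a + t * b = 1 := by
  obtain ⟨a, ha⟩ := IsBezout.gcd_dvd_left x y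
  obtain ⟨b, hb⟩ := IsBezout.gcd_dvd_right x y
  obtain ⟨s, t, hst⟩ := IsBezout.gcd_eq_sum x y
  have hg : IsBezout.gcd x y ≠ 0 := by
    intro h0
    rw [h0, zero_mul] at ha hb
    exact hxy.elim (· ha) (· hb)
  generalize IsBezout.gcd x y = g at *
  refine ⟨g, a, b, s, t, hg, ha, hb, mul_left_cancel₀ hg ?_⟩
  subst ha hb
  linear_combination hst

/-- A lower triangular `2 × 2` matrix with coprime entries represents `1`. -/
theorem IsPMStarRing.exists_triangular_eq_one (hR : IsPMStarRing R) {h z w a b c : R}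
    (habc : a * h + b * z + c * w = 1) :
    ∃ p q x y : R, p * h * x + q * z * x + q * w * y = 1 := by
  by_cases hh : h = 0
  · exact ⟨0, 1, b, c, by subst hh; linear_combination habc⟩
  by_cases hw : w = 0
  · exact ⟨a, b, 1, 0, by subst hw; linear_combination habc⟩
  by_cases hz : z = 0
  · exact ⟨a, 1, 1, c, by subst hz; linear_combination habc⟩
  -- `h` and `w` need not be coprime, so `z` is split against their cofactors; `habc` makes both
  -- factors of `z` coprime to the gcd `g` as well.
  obtain ⟨g, h', w', s, t, hg, rfl, rfl, hst⟩ :=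
    IsBezout.exists_eq_mul_isCoprime (x := h) (y := w) (Or.inl hh)
  obtain ⟨u, v, rfl, hu, hv⟩ := hR.exists_eq_mul hz ⟨s, t, hst⟩
  have hug : IsCoprime u g := ⟨b * v, a * h' + c * w', by linear_combination habc⟩
  have hvg : IsCoprime v g := ⟨b * u, a * h' + c * w', by linear_combination habc⟩
  have huh : IsCoprime u (g * h') := hug.mul_right hu
  obtain ⟨γ, δ, hγδ⟩ : IsCoprime v (g * w') := hvg.mul_right hv
  generalize g * h' = h at *
  generalize g * w' = w at *
  have hu0 : u ≠ 0 := left_ne_zero_of_mul hz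
  obtain ⟨k, α, β, σ, τ, -, hα, hβ, hστ⟩ :=
    IsBezout.exists_eq_mul_isCoprime (x := h * γ) (y := u) (Or.inr hu0)
  -- `k` divides both `u`, which is coprime to `h`, and `h * γ`, and `γ` is coprime to `w`
  have hkh : IsCoprime k h := huh.of_isCoprime_of_dvd_left ⟨β, hβ⟩
  have hkγ : k ∣ γ := hkh.dvd_of_dvd_mul_left ⟨α, hα⟩
  have hγw : IsCoprime γ w := ⟨v, δ, by linear_combination hγδ⟩
  obtain ⟨κ, ε, hκε⟩ : IsCoprime k (h * w) :=
    hkh.mul_right (hγw.of_isCoprime_of_dvd_left hkγ)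
  -- The choice `x = γ`, `y = u * δ` sends the matrix to the vector `(h * γ, u) = k • (α, β)`. The
  -- correction terms add `(h * w) • (-τ, σ)`. Since `(α, β)` and `(-τ, σ)` form a basis and `k` is
  -- coprime to `h * w`, the sum is unimodular; `(p, q)` is read off from the dual basis `(σ, τ)`,
  -- `(-β, α)`.
  refine ⟨κ * σ - ε * β, κ * τ + ε * α, γ - w * τ, u * δ + h * σ + u * v * τ, ?_⟩
  have h1 : h * (γ - w * τ) = k * α - h * w * τ := by linear_combination hα
  have h2 : u * v * (γ - w * τ) + w * (u * δ + h * σ + u * v * τ) = k * β + h * w * σ := by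
    linear_combination hβ + u * hγδ
  linear_combination (κ * σ - ε * β) * h1 + (κ * τ + ε * α) * h2 + hκε +
    (κ * k + ε * h * w) * hστ

theorem IsPMStarRing.exists_triangular_dvd (hR : IsPMStarRing R) (h z w : R) :
    ∃ p q x y : R, p * h * x + q * z * x + q * w * y ∣ h ∧
      p * h * x + q * z * x + q * w * y ∣ z ∧ p * h * x + q * z * x + q * w * y ∣ w := by
  by_cases h0 : h = 0 ∧ z = 0 ∧ w = 0
  · obtain ⟨rfl, rfl, rfl⟩ := h0
    exact ⟨0, 0, 0, 0, by simp⟩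
  by_cases hzw : z = 0 ∧ w = 0
  · obtain ⟨rfl, rfl⟩ := hzw
    exact ⟨1, 0, 1, 0, by simp⟩
  obtain ⟨g, z', w', s, t, hg, rfl, rfl, hst⟩ :=
    IsBezout.exists_eq_mul_isCoprime (x := z) (y := w) (by tauto)
  obtain ⟨d, h', g', σ, τ, hd, rfl, rfl, hστ⟩ :=
    IsBezout.exists_eq_mul_isCoprime (x := h) (y := g) (Or.inr hg)
  obtain ⟨p, q, x, y, hpq⟩ := hR.exists_triangular_eq_one
    (h := h') (z := g' * z') (w := g' * w') (a := σ) (b := τ * s) (c := τ * t)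
    (by linear_combination hστ + τ * g' * hst)
  have : p * (d * h') * x + q * (d * g' * z') * x + q * (d * g' * w') * y = d := by
    linear_combination d * hpq
  exact ⟨p, q, x, y, by rw [this]; simp [mul_assoc]⟩

end CoprimeSplitting

section Represents

open Matrix

variable {R : Type*} [CommRing R] [IsBezout R]

theorem IsBezout.exists_sum_mul_dvd {ι : Type*} [Fintype ι] (f : ι → R) :
    ∃ c : ι → R, ∀ j, ∑ i, c i * f i ∣ f j := by
  obtain ⟨w, hw⟩ := (IsBezout.isPrincipal_of_FG (Ideal.span (Set.range f))
    (Submodule.fg_span (Set.finite_range f))).principal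
  have hmem : w ∈ Ideal.span (Set.range f) := hw ▸ Submodule.mem_span_singleton_self w
  obtain ⟨c, hc⟩ := Ideal.mem_span_range_iff_exists_fun.1 hmem
  refine ⟨c, fun j => ?_⟩
  rw [hc, ← Ideal.mem_span_singleton, ← Ideal.submodule_span_eq, ← hw]
  exact Ideal.subset_span ⟨j, rfl⟩

variable [IsDomain R]

/-- Over a Bezout `PM*` domain, the greatest common divisor of the entries of a matrix is a value
of the associated bilinear form. -/
theorem IsPMStarRing.exists_dotProduct_mulVec_dvd (hR : IsPMStarRing R) {ι : Type*} [Fintype ι]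
    (m : ℕ) (A : Matrix (Fin m) ι R) :
    ∃ (p : Fin m → R) (x : ι → R), ∀ i j, p ⬝ᵥ A *ᵥ x ∣ A i j := by
  classical
  induction m with
  | zero => exact ⟨0, 0, fun i => i.elim0⟩
  | succ m ih =>
    obtain ⟨p', x', hd⟩ := ih fun i => A i.succ
    set A' : Matrix (Fin m) ι R := fun i => A i.succ with hA'
    have hsplit : ∀ (r : R) (p : Fin m → R) (x : ι → R),
        (Fin.cons r p : Fin (m + 1) → R) ⬝ᵥ A *ᵥ x = r * (A 0 ⬝ᵥ x) + p ⬝ᵥ A' *ᵥ x := by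
      intro r p x
      simp [dotProduct, Fin.sum_univ_succ, mulVec, hA']
    set d := p' ⬝ᵥ A' *ᵥ x' with hd_def
    by_cases hd0 : d = 0
    · obtain ⟨c, hc⟩ := IsBezout.exists_sum_mul_dvd (A 0)
      refine ⟨Fin.cons 1 0, c, fun i j => ?_⟩
      rw [hsplit, zero_dotProduct, add_zero, one_mul, dotProduct_comm]
      refine Fin.cases (hc j) (fun i => ?_) i
      have : A i.succ j = 0 := by simpa [hd0] using hd i j
      simp [this]
    have hrow : ∀ j, d ∣ (p' ᵥ* A') j := by
      intro j
      change d ∣ ∑ i, p' i * A' i j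
      exact Finset.dvd_sum fun i _ => (hd i j).mul_left _
    choose f hf using hrow
    have hform : ∀ x, p' ⬝ᵥ A' *ᵥ x = d * (f ⬝ᵥ x) := by
      intro x
      rw [dotProduct_mulVec]
      simp only [dotProduct, hf, Finset.mul_sum, mul_assoc]
    have hfx : f ⬝ᵥ x' = 1 := mul_left_cancel₀ hd0 (by rw [← hform, mul_one])
    set z := A 0 ⬝ᵥ x' with hz
    -- As `f ⬝ᵥ x' = 1`, the module is `R x' ⊕ ker f`, and the vectors `e_j - f j • x'` generate
    -- `ker f`. The gcd `w` of the values of row `0` on them is attained at `y'` in `ker f`. On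
    -- `x'`, `y'` the rows `p' ᵥ* A'` and `A 0` take the values `(d, 0)` and `(z, w)`: the
    -- triangular case.
    obtain ⟨c, hc⟩ := IsBezout.exists_sum_mul_dvd fun j => A 0 j - f j * z
    set w := ∑ j, c j * (A 0 j - f j * z) with hw
    let y' : ι → R := c - (f ⬝ᵥ c) • x'
    have hfy : f ⬝ᵥ y' = 0 := by
      simp [y', dotProduct_sub, hfx]
    have hby : A 0 ⬝ᵥ y' = w := by
      simp only [y', dotProduct_sub, dotProduct_smul, ← hz, hw, smul_eq_mul, mul_sub,
        Finset.sum_sub_distrib]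
      simp only [dotProduct, Finset.sum_mul]
      congr 1 <;> exact Finset.sum_congr rfl fun _ _ => by ring
    obtain ⟨p, q, x, y, h1, h2, h3⟩ := hR.exists_triangular_dvd d z w
    refine ⟨Fin.cons q (p • p'), x • x' + y • y', fun i j => ?_⟩
    have hval : (Fin.cons q (p • p') : Fin (m + 1) → R) ⬝ᵥ A *ᵥ (x • x' + y • y') =
        p * d * x + q * z * x + q * w * y := by
      rw [hsplit, smul_dotProduct, hform]
      simp only [dotProduct_add, dotProduct_smul, hfx, hfy, hby, ← hz, smul_eq_mul]
      ring
    rw [hval]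
    refine Fin.cases ?_ (fun i => h1.trans (hd i j)) i
    have : A 0 j = (A 0 j - f j * z) + f j * z := by ring
    rw [this]
    exact dvd_add (h3.trans (hc j)) (h2.mul_left _)

end Represents

/-! ### Completion of unimodular vectors to invertible matrices -/

section Completion

open Matrix

variable {R : Type*} [CommRing R]

/-- The endomorphism of `ι → R` acting on the coordinates `i` and `j` by the matrix
`!![a, b; c, d]` and fixing all other coordinates. -/
def twoCoordMap {ι : Type*} [DecidableEq ι] (i j : ι) (a b c d : R) : (ι → R) →ₗ[R] (ι → R) where
  toFun v := fun k => if k = i then a * v i + b * v j else if k = j then c * v i + d * v j else v k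
  map_add' v w := by
    ext k
    simp only [Pi.add_apply]
    split_ifs <;> ring
  map_smul' r v := by
    ext k
    simp only [Pi.smul_apply, smul_eq_mul, RingHom.id_apply]
    split_ifs <;> ring

theorem twoCoordMap_apply {ι : Type*} [DecidableEq ι] (i j : ι) (a b c d : R) (v : ι → R) (k : ι) :
    twoCoordMap i j a b c d v k =
      if k = i then a * v i + b * v j else if k = j then c * v i + d * v j else v k := rfl

theorem twoCoordMap_comp_adjugate {ι : Type*} [DecidableEq ι] {i j : ι} (hij : i ≠ j)
    {a b c d : R} (hdet : a * d - b * c = 1) :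
    twoCoordMap i j a b c d ∘ₗ twoCoordMap i j d (-b) (-c) a = LinearMap.id := by
  refine LinearMap.ext fun v => funext fun k => ?_
  simp only [LinearMap.comp_apply, twoCoordMap_apply, LinearMap.id_apply, if_neg hij.symm, if_true]
  split_ifs with h1 h2
  · subst h1; linear_combination v k * hdet
  · subst h2; linear_combination v k * hdet
  · rfl

theorem isUnit_toMatrix_twoCoordMap {ι : Type*} [Fintype ι] [DecidableEq ι] {i j : ι} (hij : i ≠ j)
    {a b c d : R} (hdet : a * d - b * c = 1) :
    IsUnit (LinearMap.toMatrix' (twoCoordMap i j a b c d)) := by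
  refine IsUnit.of_mul_eq_one (LinearMap.toMatrix' (twoCoordMap i j d (-b) (-c) a)) ?_
  rw [← LinearMap.toMatrix'_comp, twoCoordMap_comp_adjugate hij hdet, LinearMap.toMatrix'_id]

variable [IsDomain R] [IsBezout R]

theorem IsBezout.exists_isUnit_mulVec_eq_zero {ι : Type*} [Fintype ι] [DecidableEq ι] (i₀ : ι)
    (v : ι → R) (s : Finset ι) (hs : i₀ ∉ s) :
    ∃ P : Matrix ι ι R, IsUnit P ∧ ∀ i ∈ s, (P *ᵥ v) i = 0 := by
  induction s using Finset.induction_on with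
  | empty => exact ⟨1, isUnit_one, by simp⟩
  | insert j s hj ih =>
    rw [Finset.mem_insert, not_or] at hs
    obtain ⟨P, hP, hPv⟩ := ih hs.2
    by_cases h0 : (P *ᵥ v) j = 0
    · exact ⟨P, hP, by simpa [h0] using hPv⟩
    obtain ⟨g, a, b, s', t, -, ha, hb, hst⟩ :=
      IsBezout.exists_eq_mul_isCoprime (x := (P *ᵥ v) i₀) (Or.inr h0)
    -- The Bezout coefficients form the first row, which gathers the gcd at `i₀`; the cofactors
    -- `(-b, a)` form the second, which annihilates coordinate `j`.
    refine ⟨LinearMap.toMatrix' (twoCoordMap i₀ j s' t (-b) a) * P,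
      (isUnit_toMatrix_twoCoordMap hs.1 (by linear_combination hst)).mul hP, fun i hi => ?_⟩
    rw [← mulVec_mulVec, LinearMap.toMatrix'_mulVec, twoCoordMap_apply]
    have hi0 : i ≠ i₀ := by
      rintro rfl
      exact (Finset.mem_insert.1 hi).elim hs.1 hs.2
    rw [if_neg hi0]
    split_ifs with hij
    · rw [ha, hb]; ring
    · exact hPv i ((Finset.mem_insert.1 hi).resolve_left hij)

/-- Over a Bezout domain, every unimodular vector is a column of an invertible matrix. -/
theorem IsBezout.exists_isUnit_col_eq {ι : Type*} [Fintype ι] [DecidableEq ι] (i₀ : ι)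
    {c v : ι → R} (hcv : c ⬝ᵥ v = 1) :
    ∃ U : Matrix ι ι R, IsUnit U ∧ ∀ i, U i i₀ = v i := by
  obtain ⟨P, hP, hPv⟩ := IsBezout.exists_isUnit_mulVec_eq_zero i₀ v {i₀}ᶜ (by simp)
  obtain ⟨P', hP'⟩ := hP.exists_left_inv
  have hv : ∀ i, v i = P' i i₀ * (P *ᵥ v) i₀ := by
    intro i
    have h1 : v = P' *ᵥ (P *ᵥ v) := by rw [mulVec_mulVec, hP', one_mulVec]
    conv_lhs => rw [h1]
    refine Finset.sum_eq_single_of_mem i₀ (Finset.mem_univ _) fun j _ hj => ?_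
    dsimp only
    rw [hPv j (by simpa using hj), mul_zero]
  -- The only surviving entry divides every `v i`, hence divides `c ⬝ᵥ v = 1`.
  have hunit : IsUnit ((P *ᵥ v) i₀) := by
    refine IsUnit.of_mul_eq_one (∑ i, c i * P' i i₀) ?_
    rw [← hcv, Finset.mul_sum]
    refine Finset.sum_congr rfl fun i _ => ?_
    rw [hv i]
    ring
  obtain ⟨e, he⟩ := hunit
  refine ⟨(e : R) • P', ?_, fun i => ?_⟩
  · exact ((IsUnit.of_mul_eq_one P hP').smul e)
  · rw [hv i, ← he, Matrix.smul_apply, smul_eq_mul, mul_comm]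

end Completion

/-! ### Splitting off a corner entry -/

section Bordered

open Matrix

variable {R : Type*} [CommRing R] {l m n : ℕ}

/-- The block diagonal matrix with blocks `d` (of size one) and `A`. -/
def bordered (d : R) (A : Matrix (Fin m) (Fin n) R) : Matrix (Fin (m + 1)) (Fin (n + 1)) R :=
  Matrix.of (Fin.cons (Fin.cons d 0) fun i => Fin.cons 0 (A i))

@[simp] theorem bordered_zero_zero (d : R) (A : Matrix (Fin m) (Fin n) R) :
    bordered d A 0 0 = d := rfl

@[simp] theorem bordered_zero_succ (d : R) (A : Matrix (Fin m) (Fin n) R) (j : Fin n) :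
    bordered d A 0 j.succ = 0 := rfl

@[simp] theorem bordered_succ_zero (d : R) (A : Matrix (Fin m) (Fin n) R) (i : Fin m) :
    bordered d A i.succ 0 = 0 := rfl

@[simp] theorem bordered_succ_succ (d : R) (A : Matrix (Fin m) (Fin n) R) (i : Fin m)
    (j : Fin n) : bordered d A i.succ j.succ = A i j := rfl

theorem bordered_mul (d e : R) (A : Matrix (Fin l) (Fin m) R) (B : Matrix (Fin m) (Fin n) R) :
    bordered d A * bordered e B = bordered (d * e) (A * B) := by
  ext i j
  refine Fin.cases ?_ (fun i => ?_) i <;> refine Fin.cases ?_ (fun j => ?_) j <;>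
    simp [Matrix.mul_apply, Fin.sum_univ_succ]

theorem bordered_one_one : bordered (1 : R) (1 : Matrix (Fin m) (Fin m) R) = 1 := by
  ext i j
  refine Fin.cases ?_ (fun i => ?_) i <;> refine Fin.cases ?_ (fun j => ?_) j <;>
    simp [Matrix.one_apply, Fin.succ_ne_zero, (Fin.succ_ne_zero _).symm]

theorem isUnit_bordered_one {P : Matrix (Fin m) (Fin m) R} (hP : IsUnit P) :
    IsUnit (bordered 1 P) := by
  obtain ⟨Q, hQ⟩ := hP.exists_right_inv
  exact IsUnit.of_mul_eq_one (bordered 1 Q) (by rw [bordered_mul, hQ, mul_one, bordered_one_one])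

theorem IsDivisorDiagonal.bordered {d : R} {D : Matrix (Fin m) (Fin n) R}
    (hD : IsDivisorDiagonal D) (hd : ∀ i j, d ∣ D i j) : IsDivisorDiagonal (bordered d D) := by
  refine ⟨fun i j => ?_, fun k hm hn => ?_⟩
  · refine Fin.cases ?_ (fun i => ?_) i <;> refine Fin.cases ?_ (fun j => ?_) j
    · simp
    · simp
    · simp
    · intro hij
      exact hD.1 i j fun h => hij (by simp [h])
  · cases k with
    | zero => exact hd ⟨0, by omega⟩ ⟨0, by omega⟩
    | succ k => exact hD.2 k (by omega) (by omega)

theorem dvd_mul_apply_of_dvd {ι κ μ : Type*} [Fintype κ] {d : R} {A : Matrix ι κ R}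
    (hA : ∀ i j, d ∣ A i j) (B : Matrix κ μ R) (i : ι) (j : μ) : d ∣ (A * B) i j :=
  Finset.dvd_sum fun k _ => (hA i k).mul_right _

theorem dvd_mul_apply_of_dvd' {ι κ μ : Type*} [Fintype κ] {d : R} (A : Matrix ι κ R)
    {B : Matrix κ μ R} (hB : ∀ i j, d ∣ B i j) (i : ι) (j : μ) : d ∣ (A * B) i j :=
  Finset.dvd_sum fun k _ => (hB k j).mul_left _

/-- The rank-one matrix has square zero when `r ⬝ᵥ c = 0`. This covers the row and column operations
that clear the border. -/
theorem isUnit_one_sub_vecMulVec {ι : Type*} [Fintype ι] [DecidableEq ι] {c r : ι → R}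
    (h : r ⬝ᵥ c = 0) : IsUnit (1 - vecMulVec c r) := by
  refine IsUnit.of_mul_eq_one (1 + vecMulVec c r) ?_
  have : vecMulVec c r * vecMulVec c r = 0 := by
    rw [vecMulVec_mul_vecMulVec, h]
    simp
  rw [sub_mul, one_mul, mul_add, this]
  simp

/-- A matrix whose corner entry divides all entries is equivalent to a bordered matrix. -/
theorem exists_mul_mul_eq_bordered {A : Matrix (Fin (m + 1)) (Fin (n + 1)) R}
    (hA : ∀ i j, A 0 0 ∣ A i j) :
    ∃ (P : Matrix (Fin (m + 1)) (Fin (m + 1)) R) (Q : Matrix (Fin (n + 1)) (Fin (n + 1)) R)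
      (B : Matrix (Fin m) (Fin n) R),
      IsUnit P ∧ IsUnit Q ∧ P * A * Q = bordered (A 0 0) B ∧ ∀ i j, A 0 0 ∣ B i j := by
  choose c hc using fun i : Fin m => hA i.succ 0
  choose r hr using fun j : Fin n => hA 0 j.succ
  -- `P` subtracts multiples of row `0` from the rows below it, `Q` multiples of column `0` from the
  -- columns after it; the leading `0` in each `Fin.cons` leaves the corner untouched.
  set P : Matrix (Fin (m + 1)) (Fin (m + 1)) R :=
    1 - vecMulVec (Fin.cons 0 c) (Pi.single 0 1) with hP
  set Q : Matrix (Fin (n + 1)) (Fin (n + 1)) R :=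
    1 - vecMulVec (Pi.single 0 1) (Fin.cons 0 r) with hQ
  have hPA : ∀ i j, (P * A) i j = A i j - (Fin.cons 0 c : Fin (m + 1) → R) i * A 0 j := by
    intro i j
    rw [hP, Matrix.sub_mul, Matrix.one_mul, Matrix.sub_apply]
    simp [Matrix.mul_apply, vecMulVec_apply, Fin.sum_univ_succ]
  have hMQ : ∀ (M : Matrix (Fin (m + 1)) (Fin (n + 1)) R) (i j),
      (M * Q) i j = M i j - M i 0 * (Fin.cons 0 r : Fin (n + 1) → R) j := by
    intro M i j
    rw [hQ, Matrix.mul_sub, Matrix.mul_one, Matrix.sub_apply]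
    simp [Matrix.mul_apply, vecMulVec_apply, Fin.sum_univ_succ]
  refine ⟨P, Q, Matrix.of fun i j => (P * A * Q) i.succ j.succ,
    isUnit_one_sub_vecMulVec (by simp), isUnit_one_sub_vecMulVec (by simp), ?_,
    fun i j => dvd_mul_apply_of_dvd (dvd_mul_apply_of_dvd' _ hA) _ _ _⟩
  ext i j
  refine Fin.cases ?_ (fun i => ?_) i <;> refine Fin.cases ?_ (fun j => ?_) j
  · simp [hMQ, hPA]
  · simp [hMQ, hPA, hr]
  · simp [hMQ, hPA, hc, mul_comm]
  · simp

variable [IsDomain R] [IsBezout R]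

/-- If the matrix `A` represents a common divisor of its entries, then `A` is equivalent to a
matrix with this divisor as its corner entry. -/
theorem IsBezout.exists_mul_mul_corner_eq {A : Matrix (Fin (m + 1)) (Fin (n + 1)) R}
    (hA : A ≠ 0) {p : Fin (m + 1) → R} {x : Fin (n + 1) → R}
    (hpx : ∀ i j, p ⬝ᵥ A *ᵥ x ∣ A i j) :
    ∃ (P : Matrix (Fin (m + 1)) (Fin (m + 1)) R) (Q : Matrix (Fin (n + 1)) (Fin (n + 1)) R),
      IsUnit P ∧ IsUnit Q ∧ (P * A * Q) 0 0 = p ⬝ᵥ A *ᵥ x := by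
  set d := p ⬝ᵥ A *ᵥ x with hd
  have hd0 : d ≠ 0 := by
    intro h0
    exact hA (Matrix.ext fun i j => by simpa [h0] using hpx i j)
  choose B hB using hpx
  have hAB : A = d • Matrix.of B := Matrix.ext fun i j => by simp [hB]
  have h1 : p ⬝ᵥ Matrix.of B *ᵥ x = 1 := by
    refine mul_left_cancel₀ hd0 ?_
    conv_rhs => rw [mul_one, hd, hAB]
    rw [smul_mulVec, dotProduct_smul, smul_eq_mul]
  -- The single identity `h1` makes `x` unimodular against `p ᵥ* B` and `p` unimodular against `B *ᵥ
  -- x`.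
  obtain ⟨Q, hQ, hQx⟩ := IsBezout.exists_isUnit_col_eq 0 (dotProduct_mulVec p _ x ▸ h1)
  obtain ⟨P, hP, hPp⟩ := IsBezout.exists_isUnit_col_eq 0 (dotProduct_comm p _ ▸ h1)
  refine ⟨Pᵀ, Q, by simpa using hP, hQ, ?_⟩
  rw [hd, dotProduct_mulVec]
  simp [Matrix.mul_apply, dotProduct, vecMul, hQx, hPp]

end Bordered

open Matrix in
theorem theorem4 (R : Type*) [CommRing R] [IsDomain R] [IsBezout R] (hR : IsPMStarRing R) :
    IsElementaryDivisorRing R := by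
  intro m
  induction m with
  | zero => exact fun n A => ⟨1, 1, isUnit_one, isUnit_one, fun i => i.elim0, fun k hm => by omega⟩
  | succ m ih =>
    intro n A
    cases n with
    | zero => exact ⟨1, 1, isUnit_one, isUnit_one, fun _ j => j.elim0, fun k _ hn => by omega⟩
    | succ n =>
      by_cases hA : A = 0
      · exact ⟨1, 1, isUnit_one, isUnit_one, by simp [hA, IsDivisorDiagonal]⟩
      obtain ⟨p, x, hpx⟩ := hR.exists_dotProduct_mulVec_dvd (m + 1) A
      obtain ⟨P₁, Q₁, hP₁, hQ₁, h₁⟩ := IsBezout.exists_mul_mul_corner_eq hA hpx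
      obtain ⟨P₂, Q₂, B, hP₂, hQ₂, h₂, hB⟩ := exists_mul_mul_eq_bordered (A := P₁ * A * Q₁)
        fun i j => by
          rw [h₁]
          exact dvd_mul_apply_of_dvd (dvd_mul_apply_of_dvd' _ hpx) _ _ _
      obtain ⟨P₃, Q₃, hP₃, hQ₃, h₃⟩ := ih n B
      refine ⟨bordered 1 P₃ * P₂ * P₁, Q₁ * Q₂ * bordered 1 Q₃,
        ((isUnit_bordered_one hP₃).mul hP₂).mul hP₁,
        (hQ₁.mul hQ₂).mul (isUnit_bordered_one hQ₃), ?_⟩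
      have : bordered 1 P₃ * P₂ * P₁ * A * (Q₁ * Q₂ * bordered 1 Q₃) =
          bordered ((P₁ * A * Q₁) 0 0) (P₃ * B * Q₃) := by
        rw [show bordered 1 P₃ * P₂ * P₁ * A * (Q₁ * Q₂ * bordered 1 Q₃) =
          bordered 1 P₃ * (P₂ * (P₁ * A * Q₁) * Q₂) * bordered 1 Q₃ by
            simp only [Matrix.mul_assoc], h₂, bordered_mul, bordered_mul, one_mul, mul_one]
      rw [this]
      -- The corner divides all of `B`, hence all of `P₃ * B * Q₃`, so it can head the divisibility
      -- chain.
      exact h₃.bordered fun i j => dvd_mul_apply_of_dvd (dvd_mul_apply_of_dvd' _ hB) _ _ _
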